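/- Setting. There are $n$ items and one unit-demand buyer whose values $v_1,\dots,v_n\ge 0$ are independent; $v_i$ has density $f_i$, distribution function $F_i$ and finite mean. Let $\phi_i(v)=v-\frac{1-F_i(v)}{f_i(v)}$ be Myerson's virtual value. Assume that each distribution is regular: $\{f_i>0\}$ is an interval on which $\phi_i$ is strictly increasing (this covers monotone hazard rate distributions). The intermediary faces a real cost $\kappa_i$ if item $i$ is sold (in the intermediation problem $\kappa_i$ is the virtual cost of seller $i$ at its reported cost; $\kappa=0$ is the pure pricing problem). In the $k$-limited attention model the intermediary shows a set $S$ of at most $k$ items at prices $(p_i)_{i\in S}$, and the buyer buys the item of $S$ with the largest $v_i-p_i$ if that is nonnegative, and nothing otherwise. The revenue is $\mathrm{Rev}_\kappa(S,p)=\sum_{i\in S}(p_i-\kappa_i)\Pr[\text{the buyer buys } i]$. Let $Z_S=\max\bigl(0,\max_{i\in S}(\phi_i(v_i)-\kappa_i)\bigr)$, where $0$ stands for no sale, and $g_\kappa(S)=\mathbb E[Z_S]$. The greedy algorithm has access to estimates $\hat g(S)$ of $g_\kappa(S)$. It starts from the empty set and $k$ times (or until all items are chosen) adds to the current set $S$ the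 item $i\notin S$ that maximizes $\hat g(S\cup\{i\})$, taking the first such item in case of ties. Given the resulting set $S$, the anonymous virtual reserve prices are $p_i=\phi_i^{-1}(r+\kappa_i)$, where $r$ is a median of $Z_S$ and $\phi_i^{-1}$ is the generalized inverse: $\phi_i^{-1}(s)$ is the least price with virtual value at least $s$, where $\phi_i(v)=v$ if $F_i(v)=1$. Theorem. (1) Suppose that $|\hat g(S)-g_\kappa(S)|\le\varepsilon$ for all $S$ with $|S|\le k$. Then the greedy algorithm uses at most $kn$ estimates and selects a set $S$ of $\min(k,n)$ items; $Z_S$ has a median; and for every median $r$ of $Z_S$, with the prices $p$ above, $$\mathrm{Rev}_\kappa(S,p)\;\ge\;\frac{e-1}{2e}\,\mathrm{Rev}_\kappa(T,q)-k\varepsilon$$ for every set $T$ of at most $k$ items and all prices $q$. In particular, with exact values of $g_\kappa$ ($\varepsilon=0$) this is an $\frac{e-1}{2e}$-approximation to the optimal revenue in the $k$-limited attention model. (2) The greedy selection with exact values is monotone for the sellers: if item $i$ is selected for the costs $\kappa$, then it is also selected after $\kappa_i$ alone is decreased. -/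

import Mathlib

open MeasureTheory Set

noncomputable section

/-- A distribution of the buyer's value for one item: nonnegative, given by a density, with finite
mean. -/
structure ValueDist where
  pdf : ℝ → ℝ
  measurable_pdf : Measurable pdf
  pdf_nonneg : ∀ v, 0 ≤ pdf v
  lintegral_pdf : ∫⁻ v, ENNReal.ofReal (pdf v) = 1
  pdf_of_neg : ∀ v, v < 0 → pdf v = 0
  integrable_mean : Integrable (fun v => v * pdf v)

namespace ValueDist

/-- The probability measure on `ℝ` with density `pdf`. -/
def law (D : ValueDist) : Measure ℝ := volume.withDensity fun v => ENNReal.ofReal (D.pdf v)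

/-- The cumulative distribution function `F(v)`. -/
def cdf (D : ValueDist) (v : ℝ) : ℝ := D.law.real (Iic v)

/-- Myerson's virtual value `φ(v) = v - (1 - F(v)) / f(v)`. It is only used where `0 < f(v)`, or
where `F(v) = 1`, in which case it equals `v`. -/
def virtualValue (D : ValueDist) (v : ℝ) : ℝ := v - (1 - D.cdf v) / D.pdf v

/-- The density is positive on an interval, and the virtual value is strictly increasing there, so
that it can be inverted. Distributions with a monotone hazard rate have this property. -/
def IsRegular (D : ValueDist) : Prop :=
  {v | 0 < D.pdf v}.OrdConnected ∧ StrictMonoOn D.virtualValue {v | 0 < D.pdf v}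

/-- The price `φ⁻¹(s)`. It is the generalized inverse, because `φ` may have jumps: the least price
whose virtual value is at least `s`. If `s` lies below all the virtual values, this is the lower end
of the support; if `s` lies above all of them, it is a price at which the item is not sold. -/
def virtualInverse (D : ValueDist) (s : ℝ) : ℝ :=
  sInf {p | (0 < D.pdf p ∨ D.cdf p = 1) ∧ s ≤ D.virtualValue p}

end ValueDist

/-- The joint law of the buyer's independent values. -/
def valueLaw {n : ℕ} (D : Fin n → ValueDist) : Measure (Fin n → ℝ) :=
  Measure.pi fun i => (D i).law

/-- The event that a unit-demand buyer who looks at the items in `S`, offered at the prices `p`,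
buys item `i`: the surplus `v i - p i` is nonnegative and is the largest one in `S`. Ties have
probability zero, because the values are independent and have densities. -/
def buysItem {n : ℕ} (S : Finset (Fin n)) (p : Fin n → ℝ) (i : Fin n) : Set (Fin n → ℝ) :=
  {v | i ∈ S ∧ 0 ≤ v i - p i ∧ ∀ j ∈ S, v j - p j ≤ v i - p i}

/-- The intermediary's expected revenue, net of the cost `κ i` that it faces when item `i` is sold,
from showing the items in `S` at the prices `p`. -/
def revenue {n : ℕ} (D : Fin n → ValueDist) (κ : Fin n → ℝ) (S : Finset (Fin n))
    (p : Fin n → ℝ) : ℝ :=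
  ∑ i ∈ S, (p i - κ i) * (valueLaw D).real (buysItem S p i)

/-- The largest virtual value, net of costs, of an item in `S`; it is `0` (no sale) if all of them
are negative. -/
def maxVirtual {n : ℕ} (D : Fin n → ValueDist) (κ : Fin n → ℝ) (S : Finset (Fin n))
    (v : Fin n → ℝ) : ℝ :=
  S.fold max 0 fun i => (D i).virtualValue (v i) - κ i

/-- The expectation of the largest virtual value of an item in `S`. -/
def expMaxVirtual {n : ℕ} (D : Fin n → ValueDist) (κ : Fin n → ℝ) (S : Finset (Fin n)) : ℝ :=
  ∫ v, maxVirtual D κ S v ∂(valueLaw D)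

/-- `r` is a median of the random variable `Z` under the probability measure `P`. -/
def IsMedian {Ω : Type*} [MeasurableSpace Ω] (P : Measure Ω) (Z : Ω → ℝ) (r : ℝ) : Prop :=
  1 / 2 ≤ P {ω | Z ω ≤ r} ∧ 1 / 2 ≤ P {ω | r ≤ Z ω}

/-- The anonymous virtual reserve prices for the virtual reserve `r`: the value for item `i`, net of
the cost `κ i`, has the virtual value `φᵢ(v) - κ i`, and the price makes it equal to `r`. -/
def virtualReservePrices {n : ℕ} (D : Fin n → ValueDist) (κ : Fin n → ℝ) (r : ℝ) :
    Fin n → ℝ :=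
  fun i => (D i).virtualInverse (r + κ i)

/-- Programs that may query an oracle `Q → ℝ`. -/
inductive OracleProg (Q α : Type) : Type
  | done (a : α) : OracleProg Q α
  | ask (q : Q) (next : ℝ → OracleProg Q α) : OracleProg Q α

namespace OracleProg

def bind {Q α β : Type} : OracleProg Q α → (α → OracleProg Q β) → OracleProg Q β
  | done a, g => g a
  | ask q next, g => ask q fun x => bind (next x) g

/-- The result of a program with the oracle `o`. -/
def run {Q α : Type} (o : Q → ℝ) : OracleProg Q α → α
  | done a => a
  | ask q next => run o (next (o q))

/-- The number of oracle queries of a program with the oracle `o`. -/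
def queries {Q α : Type} (o : Q → ℝ) : OracleProg Q α → ℕ
  | done _ => 0
  | ask q next => queries o (next (o q)) + 1

end OracleProg

/-- Goes through a list of items and finds the first item `i` outside `S` for which the oracle's
answer to `insert i S` is largest; `best` is the best item so far, with the answer for it. -/
def scanItems {n : ℕ} (S : Finset (Fin n)) :
    List (Fin n) → Option (Fin n × ℝ) → OracleProg (Finset (Fin n)) (Option (Fin n × ℝ))
  | [], best => .done best
  | i :: l, best =>
    if i ∈ S then scanItems S l best
    else .ask (insert i S) fun x =>
      match best with
      | none => scanItems S l (some (i, x))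
      | some (j, y) => if y < x then scanItems S l (some (i, x)) else scanItems S l (some (j, y))

/-- Greedily adds up to `k` items to `S`. -/
def greedyFrom {n : ℕ} : ℕ → Finset (Fin n) → OracleProg (Finset (Fin n)) (Finset (Fin n))
  | 0, S => .done S
  | k + 1, S =>
    (scanItems S (List.finRange n) none).bind fun best =>
      match best with
      | none => .done S
      | some (i, _) => greedyFrom k (insert i S)

/-- The greedy algorithm that selects the `k` items to show (all items if there are fewer). -/
def greedy (n k : ℕ) : OracleProg (Finset (Fin n)) (Finset (Fin n)) := greedyFrom k ∅

end

/-! The benchmark linking both sides is g(S) = E[Z_S]. Upper bound: with the other values fixed, the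
buyer takes item i exactly when v_i passes a threshold at least q_i. Myerson's integration by parts
bounds the revenue from i by the virtual surplus collected there, and ties are null, so the revenue
is at most g(T) (`revenue_le_expMaxVirtual`). Lower bound, as in a prophet inequality: g(S) ≤ r + Σ
E[(φ_i - κ_i - r)⁺]. At the reserve prices the revenue is r times the probability of a sale plus the
margins above r. Since r is a median, a sale has probability at least 1/2 when r > 0, and each item
is, with probability at least 1/2 and independently of its own value, the only one that can be
afforded. So half of each term is collected (`half_expMaxVirtual_le_revenue`). Selection: g is
monotone with subadditive marginal gains, so noisy greedy obtains (1 - 1/e) g(T) - 2kε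
(`le_run_greedy`). Halving gives the constant and the loss kε. Monotonicity in the costs: lowering
κ_i raises g only on sets containing i, so the run is unchanged until i is chosen
(`mem_run_greedyFrom_of_le`). -/

namespace ValueDist

variable (D : ValueDist)

instance isProbabilityMeasure_law : IsProbabilityMeasure D.law :=
  ⟨by rw [law, withDensity_apply _ MeasurableSet.univ, Measure.restrict_univ, D.lintegral_pdf]⟩

theorem measurable_ofReal_pdf : Measurable fun v => ENNReal.ofReal (D.pdf v) :=
  D.measurable_pdf.ennreal_ofReal

instance nullSingletonClass_law : NullSingletonClass D.law := by
  unfold law; infer_instance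

theorem ae_pdf_pos : ∀ᵐ v ∂D.law, 0 < D.pdf v := by
  rw [law, ae_withDensity_iff D.measurable_ofReal_pdf]
  exact .of_forall fun v hv => ENNReal.ofReal_pos.1 (pos_iff_ne_zero.2 hv)

theorem setIntegral_law (g : ℝ → ℝ) {s : Set ℝ} (hs : MeasurableSet s) :
    ∫ v in s, g v ∂D.law = ∫ v in s, D.pdf v * g v := by
  rw [law, setIntegral_withDensity_eq_setIntegral_toReal_smul D.measurable_ofReal_pdf
    (.of_forall fun _ => ENNReal.ofReal_lt_top) _ hs]
  simp [ENNReal.toReal_ofReal (D.pdf_nonneg _)]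

theorem integrable_law_iff (g : ℝ → ℝ) :
    Integrable g D.law ↔ Integrable fun v => D.pdf v * g v := by
  rw [law, integrable_withDensity_iff_integrable_smul' D.measurable_ofReal_pdf
    (.of_forall fun _ => ENNReal.ofReal_lt_top)]
  simp [ENNReal.toReal_ofReal (D.pdf_nonneg _)]

theorem integrable_id_law : Integrable (fun v => v) D.law := by
  simpa only [integrable_law_iff, mul_comm] using D.integrable_mean

theorem one_sub_cdf (v : ℝ) : 1 - D.cdf v = D.law.real (Ioi v) := by
  rw [cdf, ← compl_Iic, measureReal_compl measurableSet_Iic, probReal_univ]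

theorem monotone_cdf : Monotone D.cdf := fun _ _ h =>
  measureReal_mono (Iic_subset_Iic.2 h)

theorem cdf_le_one (v : ℝ) : D.cdf v ≤ 1 := measureReal_le_one

theorem measurable_virtualValue : Measurable D.virtualValue :=
  measurable_id.sub ((D.monotone_cdf.measurable.const_sub 1).div D.measurable_pdf)

theorem nonneg_of_pdf_pos {v : ℝ} (h : 0 < D.pdf v) : 0 ≤ v := by
  by_contra! hv
  exact h.ne' (D.pdf_of_neg v hv)

theorem virtualValue_of_cdf_eq_one {v : ℝ} (h : D.cdf v = 1) : D.virtualValue v = v := by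
  simp [virtualValue, h]

theorem virtualValue_le (v : ℝ) : D.virtualValue v ≤ v :=
  sub_le_self _ (div_nonneg (sub_nonneg.2 (D.cdf_le_one v)) (D.pdf_nonneg v))

/-! ### The expected virtual value above a threshold -/

/-- Layer-cake formula for the excess over t, translated by t. -/
theorem lintegral_meas_Ioi (t : ℝ) :
    ∫⁻ v in Ioi t, D.law (Ioi v) = ∫⁻ v, ENNReal.ofReal (max (v - t) 0) ∂D.law := by
  rw [lintegral_eq_lintegral_meas_lt (f := fun v => max (v - t) 0) D.law
    (.of_forall fun _ => le_max_right _ _) (by fun_prop)]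
  have h := (measurePreserving_add_right volume t).setLIntegral_comp_preimage_emb
    (measurableEmbedding_addRight t) (fun v => D.law (Ioi v)) (Ioi t)
  rw [← h]
  have : (fun x : ℝ => x + t) ⁻¹' Ioi t = Ioi 0 := by ext; simp
  rw [this]
  refine setLIntegral_congr_fun measurableSet_Ioi fun u hu => ?_
  congr 1
  ext x
  simp only [mem_Ioi, mem_ofPred_eq, lt_max_iff] at hu ⊢
  constructor
  · intro h; left; linarith
  · rintro (h | h) <;> linarith

theorem integrable_posPart_sub (t : ℝ) : Integrable (fun v => max (v - t) 0) D.law :=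
  (D.integrable_id_law.sub (integrable_const t)).pos_part

theorem integrableOn_meas_Ioi (t : ℝ) : IntegrableOn (fun v => D.law.real (Ioi v)) (Ici t) := by
  rw [integrableOn_Ici_iff_integrableOn_Ioi]
  refine integrable_toReal_of_lintegral_ne_top ?_ ?_
  · have : Antitone fun v => D.law (Ioi v) := fun _ _ h => measure_mono (Ioi_subset_Ioi h)
    exact this.measurable.aemeasurable
  · rw [D.lintegral_meas_Ioi]
    exact ((hasFiniteIntegral_iff_ofReal (.of_forall fun _ => le_max_right _ _)).1
      (D.integrable_posPart_sub t).2).ne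

theorem setIntegral_meas_Ioi (t : ℝ) :
    ∫ v in Ici t, D.law.real (Ioi v) = ∫ v in Ici t, v ∂D.law - t * D.law.real (Ici t) := by
  have h1 : ∫ v in Ici t, D.law.real (Ioi v) = ∫ v, max (v - t) 0 ∂D.law := by
    rw [integral_Ici_eq_integral_Ioi, integral_eq_lintegral_of_nonneg_ae
      (f := fun v => max (v - t) 0) (.of_forall fun _ => le_max_right _ _) (D.integrable_posPart_sub t).1,
      ← D.lintegral_meas_Ioi]
    have : Antitone fun v => D.law (Ioi v) := fun _ _ h => measure_mono (Ioi_subset_Ioi h)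
    exact integral_toReal this.measurable.aemeasurable (.of_forall fun _ => measure_lt_top _ _)
  have h2 : (fun v => max (v - t) 0) = (Ici t).indicator fun v => v - t := by
    ext v
    by_cases hv : t ≤ v
    · rw [indicator_of_mem (mem_Ici.2 hv), max_eq_left (sub_nonneg.2 hv)]
    · rw [indicator_of_notMem (by simpa using hv), max_eq_right (by linarith)]
  rw [h1, h2, integral_indicator measurableSet_Ici,
    integral_sub D.integrable_id_law.integrableOn (integrable_const t)]
  simp [mul_comm]

/-- The indicator is needed because the factor f cancels the denominator of φ only where f > 0. -/
theorem pdf_mul_virtualValue (v : ℝ) : D.pdf v * D.virtualValue v =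
    D.pdf v * v - {v | 0 < D.pdf v}.indicator (fun v => D.law.real (Ioi v)) v := by
  rw [virtualValue, one_sub_cdf]
  by_cases h : 0 < D.pdf v
  · rw [indicator_of_mem (by exact h)]
    field_simp
  · rw [indicator_of_notMem (by exact h), (D.pdf_nonneg v).antisymm' (not_lt.1 h)]
    simp

theorem measurableSet_pdf_pos : MeasurableSet {v | 0 < D.pdf v} :=
  measurableSet_lt measurable_const D.measurable_pdf

theorem integrable_virtualValue : Integrable D.virtualValue D.law := by
  rw [integrable_law_iff]
  simp only [pdf_mul_virtualValue]
  refine ((D.integrable_law_iff _).1 D.integrable_id_law).sub ?_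
  rw [integrable_indicator_iff D.measurableSet_pdf_pos]
  exact (D.integrableOn_meas_Ioi 0).mono_set fun v hv => D.nonneg_of_pdf_pos hv

/-- Myerson's identity by integration by parts, kept exact: the last term is the tail mass
integrated over the points above t where the density vanishes. Its sign gives the bound for every
price; its vanishing gives equality at a virtual reserve. -/
theorem setIntegral_virtualValue (t : ℝ) :
    ∫ v in Ici t, D.virtualValue v ∂D.law = t * D.law.real (Ici t) +
      ∫ v in Ici t, {v | 0 < D.pdf v}ᶜ.indicator (fun v => D.law.real (Ioi v)) v := by
  have hi := D.integrableOn_meas_Ioi t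
  have hid : IntegrableOn (fun v => D.pdf v * v) (Ici t) :=
    ((D.integrable_law_iff _).1 D.integrable_id_law).integrableOn
  rw [D.setIntegral_law _ measurableSet_Ici]
  simp only [pdf_mul_virtualValue]
  rw [integral_sub hid (hi.indicator D.measurableSet_pdf_pos),
    ← D.setIntegral_law _ measurableSet_Ici]
  have h := D.setIntegral_meas_Ioi t
  have : ∫ v in Ici t, D.law.real (Ioi v) =
      (∫ v in Ici t, {v | 0 < D.pdf v}.indicator (fun v => D.law.real (Ioi v)) v) +
      ∫ v in Ici t, {v | 0 < D.pdf v}ᶜ.indicator (fun v => D.law.real (Ioi v)) v := by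
    rw [← integral_add (hi.indicator D.measurableSet_pdf_pos)
      (hi.indicator D.measurableSet_pdf_pos.compl)]
    refine integral_congr_ae (.of_forall fun v => ?_)
    exact (congrFun (indicator_self_add_compl {v | 0 < D.pdf v} fun v => D.law.real (Ioi v)) v).symm
  linarith

theorem mul_meas_Ici_le (t : ℝ) :
    t * D.law.real (Ici t) ≤ ∫ v in Ici t, D.virtualValue v ∂D.law := by
  rw [setIntegral_virtualValue]
  exact le_add_of_nonneg_right (integral_nonneg fun v =>
    indicator_nonneg (fun _ _ => measureReal_nonneg) _)

theorem setIntegral_virtualValue_eq {t : ℝ} (h : ∀ v, t < v → 0 < D.pdf v ∨ D.cdf v = 1) :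
    ∫ v in Ici t, D.virtualValue v ∂D.law = t * D.law.real (Ici t) := by
  rw [setIntegral_virtualValue, add_eq_left, integral_Ici_eq_integral_Ioi]
  refine (setIntegral_congr_fun measurableSet_Ioi fun v hv => ?_).trans (integral_zero _ _)
  refine indicator_apply_eq_zero.2 fun hv' => ?_
  rw [← one_sub_cdf, (h v hv).resolve_left hv', sub_self]

/-! ### The generalized inverse of the virtual value -/

/-- The virtual value is meaningful on this set. -/
def domain : Set ℝ := {v | 0 < D.pdf v ∨ D.cdf v = 1}

/-- Some u ≤ p has positive density, so for v > p the interval assumption would make the density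
positive on all of (p, v], where there is no mass. -/
theorem le_of_cdf_eq_one (hD : D.IsRegular) {p v : ℝ} (hp : D.cdf p = 1) (hv : 0 < D.pdf v) :
    v ≤ p := by
  by_contra! hpv
  obtain ⟨u, hu, hup⟩ : ∃ u, 0 < D.pdf u ∧ u ≤ p := by
    by_contra! hc
    have h0 : D.law (Iic p) = 0 :=
      measure_mono_null (fun x hx h => (hc x h).not_ge hx) D.ae_pdf_pos
    simp [cdf, measureReal_def, h0] at hp
  have h0 : D.law (Ioi p) = 0 := by
    have := D.one_sub_cdf p
    rw [hp, sub_self, eq_comm, measureReal_eq_zero_iff] at this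
    exact this
  rw [law, withDensity_apply _ measurableSet_Ioi,
    lintegral_eq_zero_iff D.measurable_ofReal_pdf, Filter.EventuallyEq,
    ae_restrict_iff' measurableSet_Ioi] at h0
  have h1 : volume (Ioc p v) = 0 := by
    refine measure_mono_null (fun x hx => ?_) (ae_iff.1 h0)
    intro h
    have hx' : 0 < D.pdf x := hD.1.out hu hv ⟨hup.trans hx.1.le, hx.2⟩
    exact (ENNReal.ofReal_pos.2 hx').ne' (h hx.1)
  simp at h1
  linarith

theorem strictMonoOn_virtualValue (hD : D.IsRegular) : StrictMonoOn D.virtualValue D.domain := by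
  intro x hx y hy hxy
  rcases hy with hy | hy
  · rcases hx with hx | hx
    · exact hD.2 hx hy hxy
    · exact absurd (D.le_of_cdf_eq_one hD hx hy) hxy.not_ge
  · rw [D.virtualValue_of_cdf_eq_one hy]
    exact (D.virtualValue_le x).trans_lt hxy

theorem nonneg_of_mem_domain {v : ℝ} (h : v ∈ D.domain) : 0 ≤ v := by
  rcases h with h | h
  · exact D.nonneg_of_pdf_pos h
  · by_contra! hv
    have : D.law (Iic v) = 0 := measure_mono_null
      (fun x hx hpos => (D.nonneg_of_pdf_pos hpos).not_gt (lt_of_le_of_lt hx hv)) D.ae_pdf_pos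
    simp [cdf, measureReal_def, this] at h

theorem mem_domain_of_lt (hD : D.IsRegular) {u v : ℝ} (hu : u ∈ D.domain) (huv : u < v) :
    v ∈ D.domain := by
  rcases hu with hu | hu
  · by_cases hv : 0 < D.pdf v
    · exact .inl hv
    · right
      have : D.law.real (Ioi v) = 0 := by
        rw [measureReal_eq_zero_iff]
        exact measure_mono_null
          (fun x hx hpos => hv (hD.1.out hu hpos ⟨huv.le, (le_of_lt hx)⟩)) D.ae_pdf_pos
      linarith [D.one_sub_cdf v]
  · exact .inr ((D.cdf_le_one v).antisymm (hu ▸ D.monotone_cdf huv.le))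

/-- Above every level there is a virtual value: the mean is finite. -/
theorem exists_le_virtualValue (s : ℝ) : ∃ p ∈ D.domain, s ≤ D.virtualValue p := by
  by_contra! hc
  have hne (t : ℝ) (ht : s ≤ t) : D.cdf t ≠ 1 := fun h =>
    (hc t (.inr h)).not_ge (by rwa [D.virtualValue_of_cdf_eq_one h])
  have hpos : 0 < D.law.real (Ici (s + 1)) := by
    refine lt_of_lt_of_le ?_ (measureReal_mono (Ioi_subset_Ici_self (a := s + 1)))
    rw [← one_sub_cdf, sub_pos]
    exact (D.cdf_le_one _).lt_of_ne (hne _ (by linarith))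
  -- If all virtual values were below s, the tail at s + 1, of positive mass m, would give (s + 1) m
  -- ≤ s m.
  have h1 := D.mul_meas_Ici_le (s + 1)
  have h2 : ∫ v in Ici (s + 1), D.virtualValue v ∂D.law ≤ ∫ _ in Ici (s + 1), s ∂D.law := by
    refine integral_mono_ae D.integrable_virtualValue.integrableOn (integrable_const s) ?_
    filter_upwards [ae_restrict_of_ae D.ae_pdf_pos] with v hv using (hc v (.inl hv)).le
  rw [setIntegral_const, smul_eq_mul] at h2
  nlinarith

theorem virtualInverse_set_bddBelow (s : ℝ) :
    BddBelow {p | (0 < D.pdf p ∨ D.cdf p = 1) ∧ s ≤ D.virtualValue p} :=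
  ⟨0, fun _ hp => D.nonneg_of_mem_domain hp.1⟩

theorem le_virtualInverse (s : ℝ) : s ≤ D.virtualInverse s := by
  obtain ⟨p, hp, hs⟩ := D.exists_le_virtualValue s
  exact le_csInf ⟨p, hp, hs⟩ fun q hq => hq.2.trans (D.virtualValue_le q)

theorem exists_lt_of_virtualInverse_lt {s v : ℝ} (h : D.virtualInverse s < v) :
    ∃ p ∈ D.domain, s ≤ D.virtualValue p ∧ p < v := by
  obtain ⟨p, hp, hs⟩ := D.exists_le_virtualValue s
  obtain ⟨q, hq, hqv⟩ := exists_lt_of_csInf_lt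
    (s := {p | (0 < D.pdf p ∨ D.cdf p = 1) ∧ s ≤ D.virtualValue p}) ⟨p, hp, hs⟩ h
  exact ⟨q, hq.1, hq.2, hqv⟩

/-- The infimum need not be attained when φ jumps, so the equivalence can fail at that one point,
which is null. -/
theorem ae_virtualInverse_le_iff (hD : D.IsRegular) (s : ℝ) :
    ∀ᵐ v ∂D.law, (D.virtualInverse s ≤ v ↔ s ≤ D.virtualValue v) := by
  filter_upwards [D.ae_pdf_pos, compl_mem_ae_iff.2 (measure_singleton (D.virtualInverse s))]
    with v hv hne
  refine ⟨fun h => ?_, fun h => csInf_le (D.virtualInverse_set_bddBelow s) ⟨.inl hv, h⟩⟩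
  obtain ⟨p, hp, hs, hpv⟩ := D.exists_lt_of_virtualInverse_lt (h.lt_of_ne fun h => hne h.symm)
  exact hs.trans (D.strictMonoOn_virtualValue hD hp (.inl hv) hpv).le

theorem ae_virtualValue_ne (hD : D.IsRegular) (s : ℝ) : ∀ᵐ v ∂D.law, D.virtualValue v ≠ s := by
  have : D.law {v | 0 < D.pdf v ∧ D.virtualValue v = s} = 0 := by
    refine Subsingleton.measure_zero (fun x hx y hy => ?_) _
    exact hD.2.injOn hx.1 hy.1 (hx.2.trans hy.2.symm)
  filter_upwards [D.ae_pdf_pos, compl_mem_ae_iff.2 this] with v hv h hs using h ⟨hv, hs⟩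

/-- `domain` is closed upwards and has points arbitrarily close to the infimum, so no gap in the
support remains above the reserve price. -/
theorem setIntegral_virtualInverse (hD : D.IsRegular) (s : ℝ) :
    ∫ v in Ici (D.virtualInverse s), D.virtualValue v ∂D.law =
      D.virtualInverse s * D.law.real (Ici (D.virtualInverse s)) := by
  refine D.setIntegral_virtualValue_eq fun v hv => ?_
  obtain ⟨p, hp, -, hpv⟩ := D.exists_lt_of_virtualInverse_lt hv
  exact D.mem_domain_of_lt hD hp hpv

/-- The expected excess of the virtual value over `s` is the revenue above `s` from the
price `φ⁻¹(s)`. -/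
theorem integral_posPart_virtualValue (hD : D.IsRegular) (s : ℝ) :
    ∫ v, max (D.virtualValue v - s) 0 ∂D.law =
      (D.virtualInverse s - s) * D.law.real (Ici (D.virtualInverse s)) := by
  have h1 : (fun v => max (D.virtualValue v - s) 0) =ᵐ[D.law]
      (Ici (D.virtualInverse s)).indicator fun v => D.virtualValue v - s := by
    filter_upwards [D.ae_virtualInverse_le_iff hD s] with v hv
    by_cases h : D.virtualInverse s ≤ v
    · rw [indicator_of_mem (mem_Ici.2 h), max_eq_left (sub_nonneg.2 (hv.1 h))]
    · rw [indicator_of_notMem (by simpa using h), max_eq_right]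
      linarith [not_le.1 (mt hv.2 h)]
  rw [integral_congr_ae h1, integral_indicator measurableSet_Ici,
    integral_sub D.integrable_virtualValue.integrableOn (integrable_const s),
    D.setIntegral_virtualInverse hD]
  simp
  ring

end ValueDist

/-! ### Semantics of oracle programs -/

namespace OracleProg

variable {Q α β : Type} (o : Q → ℝ)

@[simp] theorem run_done (a : α) : run o (done a : OracleProg Q α) = a := rfl
@[simp] theorem run_ask (q : Q) (next : ℝ → OracleProg Q α) :
    run o (ask q next) = run o (next (o q)) := rfl
@[simp] theorem queries_done (a : α) : queries o (done a : OracleProg Q α) = 0 := rfl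
@[simp] theorem queries_ask (q : Q) (next : ℝ → OracleProg Q α) :
    queries o (ask q next) = queries o (next (o q)) + 1 := rfl

theorem run_bind (m : OracleProg Q α) (g : α → OracleProg Q β) :
    (m.bind g).run o = (g (m.run o)).run o := by
  induction m with
  | done a => rfl
  | ask q next ih => exact ih _

theorem queries_bind (m : OracleProg Q α) (g : α → OracleProg Q β) :
    (m.bind g).queries o = m.queries o + (g (m.run o)).queries o := by
  induction m with
  | done a => simp [OracleProg.bind, run]
  | ask q next ih =>
    simp only [OracleProg.bind, queries_ask, run_ask, ih]
    omega

end OracleProg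

/-! ### Greedy selection: query count, approximation, monotonicity -/

section Greedy

variable {n : ℕ} (est : Finset (Fin n) → ℝ)

theorem queries_scanItems_le (S : Finset (Fin n)) (l : List (Fin n))
    (best : Option (Fin n × ℝ)) : (scanItems S l best).queries est ≤ l.length := by
  induction l generalizing best with
  | nil => simp [scanItems]
  | cons i l ih =>
    rw [scanItems]
    split_ifs
    · exact (ih best).trans (by simp)
    · rw [OracleProg.queries_ask, List.length_cons]
      refine Nat.succ_le_succ ?_
      rcases best with _ | ⟨j, y⟩
      · exact ih _
      · dsimp only
        split_ifs <;> exact ih _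

theorem queries_greedyFrom_le (k : ℕ) (S : Finset (Fin n)) :
    (greedyFrom k S).queries est ≤ k * n := by
  induction k generalizing S with
  | zero => simp [greedyFrom]
  | succ k ih =>
    rw [greedyFrom, OracleProg.queries_bind, Nat.succ_mul, Nat.add_comm]
    have h1 : (scanItems S (List.finRange n) none).queries est ≤ n := by
      simpa using queries_scanItems_le est S (List.finRange n) none
    refine Nat.add_le_add ?_ h1
    rcases (scanItems S (List.finRange n) none).run est with _ | ⟨i, x⟩
    · simp
    · exact ih _

/-- `i` is the first item outside `S` for which the estimate for `insert i S` is largest. -/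
def IsFirstBest (S : Finset (Fin n)) (i : Fin n) : Prop :=
  i ∉ S ∧ (∀ j ∉ S, est (insert j S) ≤ est (insert i S)) ∧
    ∀ j ∉ S, j < i → est (insert j S) < est (insert i S)

theorem IsFirstBest.unique {est : Finset (Fin n) → ℝ} {S : Finset (Fin n)} {i j : Fin n}
    (hi : IsFirstBest est S i) (hj : IsFirstBest est S j) : i = j := by
  rcases lt_trichotomy i j with h | h | h
  · exact absurd (hi.2.1 j hj.1) (hj.2.2 i hi.1 h).not_ge
  · exact h
  · exact absurd (hj.2.1 i hi.1) (hi.2.2 j hj.1 h).not_ge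

/-- The candidate changes only on strict improvement, and the list is increasing; the clause
comparing `i` with `b` carries this strictness through the induction and yields the tie-breaking
rule. -/
theorem exists_run_scanItems_some (S : Finset (Fin n)) (l : List (Fin n)) (hl : l.Pairwise (· < ·))
    (b : Fin n) (hb : b ∉ S) (hbl : ∀ j ∈ l, b < j) :
    ∃ i, (scanItems S l (some (b, est (insert b S)))).run est = some (i, est (insert i S)) ∧
      i ∉ S ∧ (i = b ∨ b < i ∧ est (insert b S) < est (insert i S)) ∧
      ∀ j ∈ l, j ∉ S → est (insert j S) ≤ est (insert i S) ∧
        (j < i → est (insert j S) < est (insert i S)) := by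
  induction l generalizing b with
  | nil => exact ⟨b, by simp [scanItems], hb, .inl rfl, by simp⟩
  | cons a l ih =>
    rw [List.pairwise_cons] at hl
    have hbl' : ∀ j ∈ l, b < j := fun j hj => hbl j (List.mem_cons_of_mem _ hj)
    rw [scanItems]
    split_ifs with ha
    · obtain ⟨i, h1, h2, h3, h4⟩ := ih hl.2 b hb hbl'
      refine ⟨i, h1, h2, h3, fun j hj hjS => ?_⟩
      rcases List.mem_cons.1 hj with rfl | hj
      · exact absurd ha hjS
      · exact h4 j hj hjS
    · rw [OracleProg.run_ask]
      dsimp only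
      have hba : b < a := hbl a List.mem_cons_self
      split_ifs with hlt
      · obtain ⟨i, h1, h2, h3, h4⟩ := ih hl.2 a ha hl.1
        refine ⟨i, h1, h2, .inr ?_, fun j hj hjS => ?_⟩
        · rcases h3 with rfl | h3
          · exact ⟨hba, hlt⟩
          · exact ⟨hba.trans h3.1, hlt.trans h3.2⟩
        · rcases List.mem_cons.1 hj with rfl | hj
          · rcases h3 with rfl | h3
            · exact ⟨le_rfl, fun h => absurd h (lt_irrefl _)⟩
            · exact ⟨h3.2.le, fun _ => h3.2⟩
          · exact h4 j hj hjS
      · obtain ⟨i, h1, h2, h3, h4⟩ := ih hl.2 b hb hbl'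
        refine ⟨i, h1, h2, h3, fun j hj hjS => ?_⟩
        rcases List.mem_cons.1 hj with rfl | hj
        · rcases h3 with rfl | h3
          · exact ⟨not_lt.1 hlt, fun h => absurd h hba.not_gt⟩
          · exact ⟨(not_lt.1 hlt).trans h3.2.le, fun _ => (not_lt.1 hlt).trans_lt h3.2⟩
        · exact h4 j hj hjS

theorem run_scanItems_none (S : Finset (Fin n)) (l : List (Fin n)) (hl : l.Pairwise (· < ·)) :
    ((∀ j ∈ l, j ∈ S) ∧ (scanItems S l none).run est = none) ∨
    ∃ i, (scanItems S l none).run est = some (i, est (insert i S)) ∧ i ∉ S ∧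
      ∀ j ∈ l, j ∉ S → est (insert j S) ≤ est (insert i S) ∧
        (j < i → est (insert j S) < est (insert i S)) := by
  induction l with
  | nil => exact .inl ⟨by simp, by simp [scanItems]⟩
  | cons a l ih =>
    rw [List.pairwise_cons] at hl
    rw [scanItems]
    split_ifs with ha
    · rcases ih hl.2 with ⟨h1, h2⟩ | ⟨i, h1, h2, h3⟩
      · exact .inl ⟨by simpa [ha] using h1, h2⟩
      · refine .inr ⟨i, h1, h2, fun j hj hjS => ?_⟩
        rcases List.mem_cons.1 hj with rfl | hj
        · exact absurd ha hjS
        · exact h3 j hj hjS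
    · right
      rw [OracleProg.run_ask]
      obtain ⟨i, h1, h2, h3, h4⟩ := exists_run_scanItems_some est S l hl.2 a ha hl.1
      refine ⟨i, h1, h2, fun j hj hjS => ?_⟩
      rcases List.mem_cons.1 hj with rfl | hj
      · rcases h3 with rfl | h3
        · exact ⟨le_rfl, fun h => absurd h (lt_irrefl _)⟩
        · exact ⟨h3.2.le, fun _ => h3.2⟩
      · exact h4 j hj hjS

/-- One round of the greedy algorithm: it stops if all items are chosen and otherwise adds the
first best item. -/
theorem run_greedyFrom_succ (k : ℕ) (S : Finset (Fin n)) :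
    (S = Finset.univ ∧ (greedyFrom (k + 1) S).run est = S) ∨
    ∃ i, IsFirstBest est S i ∧
      (greedyFrom (k + 1) S).run est = (greedyFrom k (insert i S)).run est := by
  rw [greedyFrom, OracleProg.run_bind]
  rcases run_scanItems_none est S (List.finRange n) (List.pairwise_lt_finRange n) with
    ⟨h1, h2⟩ | ⟨i, h1, h2, h3⟩
  · exact .inl ⟨Finset.eq_univ_iff_forall.2 fun j => h1 j (List.mem_finRange j), by simp [h2]⟩
  · exact .inr ⟨i, ⟨h2, fun j hj => (h3 j (List.mem_finRange j) hj).1,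
      fun j hj => (h3 j (List.mem_finRange j) hj).2⟩, by simp [h1]⟩

theorem subset_run_greedyFrom (k : ℕ) (S : Finset (Fin n)) :
    S ⊆ (greedyFrom k S).run est := by
  induction k generalizing S with
  | zero => simp [greedyFrom]
  | succ k ih =>
    rcases run_greedyFrom_succ est k S with ⟨-, h⟩ | ⟨i, -, h⟩
    · rw [h]
    · rw [h]; exact (Finset.subset_insert i S).trans (ih _)

theorem card_run_greedyFrom (k : ℕ) (S : Finset (Fin n)) :
    ((greedyFrom k S).run est).card = min (S.card + k) n := by
  induction k generalizing S with
  | zero => simpa [greedyFrom] using S.card_le_univ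
  | succ k ih =>
    rcases run_greedyFrom_succ est k S with ⟨rfl, h⟩ | ⟨i, hi, h⟩
    · simp [h]
    · rw [h, ih, Finset.card_insert_of_notMem hi.1]
      congr 1
      omega

/-- If `est'` agrees with `est` on the sets without `i` and is at least `est` on the sets with
`i`, then greedy selection with `est'` selects `i` if greedy selection with `est` does. -/
theorem mem_run_greedyFrom_of_le {est est' : Finset (Fin n) → ℝ} {i : Fin n}
    (heq : ∀ S, i ∉ S → est' S = est S) (hle : ∀ S, est S ≤ est' S) (k : ℕ) (S : Finset (Fin n))
    (h : i ∈ (greedyFrom k S).run est) : i ∈ (greedyFrom k S).run est' := by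
  induction k generalizing S with
  | zero => exact h
  | succ k ih =>
    by_cases hiS : i ∈ S
    · exact subset_run_greedyFrom est' _ S hiS
    have hne : S ≠ Finset.univ := fun hS => hiS (hS ▸ Finset.mem_univ i)
    obtain ⟨a, ha, hra⟩ := (run_greedyFrom_succ est k S).resolve_left fun h => hne h.1
    obtain ⟨b, hb, hrb⟩ := (run_greedyFrom_succ est' k S).resolve_left fun h => hne h.1
    rw [hra] at h
    rw [hrb]
    have hins (j : Fin n) (hj : j ≠ i) : est' (insert j S) = est (insert j S) :=
      heq _ (by simp [hiS, hj.symm])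
    by_cases hbi : b = i
    · exact subset_run_greedyFrom est' _ _ (hbi ▸ Finset.mem_insert_self b S)
    -- The estimate for `b` is unchanged and the others did not decrease, so `b` is already first
    -- best for `est`.
    have hab : a = b := by
      refine ha.unique ⟨hb.1, fun j hj => ?_, fun j hj hjb => ?_⟩
      · exact (hle _).trans ((hb.2.1 j hj).trans_eq (hins b hbi))
      · exact (hle _).trans_lt ((hb.2.2 j hj hjb).trans_eq (hins b hbi))
    rw [← hab]
    exact ih _ (hab ▸ h)

/-- The loss of greedy selection with estimates of a monotone function `g` whose marginal gains are
subadditive. -/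
theorem gap_run_greedyFrom_le {g : Finset (Fin n) → ℝ} (hmono : Monotone g)
    (hsub : ∀ S T, g T - g S ≤ ∑ i ∈ T, (g (insert i S) - g S)) {K : ℕ} (hK : 0 < K) {ε : ℝ}
    (hest : ∀ S : Finset (Fin n), S.card ≤ K → |est S - g S| ≤ ε)
    {T : Finset (Fin n)} (hT : T.card ≤ K) (k : ℕ) (S : Finset (Fin n)) (hS : S.card + k ≤ K)
    {h : ℝ} (h0 : 0 ≤ h) (hh : g T - g S ≤ h) :
    g T - g ((greedyFrom k S).run est) ≤ (1 - 1 / (K : ℝ)) ^ k * h + 2 * k * ε := by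
  have hε : 0 ≤ ε := (abs_nonneg _).trans (hest ∅ (by simp))
  have hK' : (1 : ℝ) ≤ K := by exact_mod_cast hK
  have hq : 0 ≤ 1 - 1 / (K : ℝ) := sub_nonneg.2 ((div_le_one (by linarith)).2 hK')
  -- Each round multiplies the gap by 1 - 1/K and adds 2ε. The induction runs over a nonnegative
  -- bound `h`, because the gap itself may be negative.
  induction k generalizing S h with
  | zero => simpa [greedyFrom] using hh
  | succ k ih =>
    rcases run_greedyFrom_succ est k S with ⟨hu, hr⟩ | ⟨i, hi, hr⟩
    · rw [hr, hu]
      have : g T ≤ g Finset.univ := hmono (Finset.subset_univ T)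
      have h1 : 0 ≤ (1 - 1 / (K : ℝ)) ^ (k + 1) * h := by positivity
      have h2 : 0 ≤ 2 * ((k + 1 : ℕ) : ℝ) * ε := by positivity
      linarith
    · rw [hr]
      have hcard (j : Fin n) : (insert j S).card ≤ K :=
        (Finset.card_insert_le j S).trans (by omega)
      -- One ε for each of the two estimates compared.
      have hgain (j : Fin n) : g (insert j S) - g S ≤ g (insert i S) - g S + 2 * ε := by
        by_cases hj : j ∈ S
        · rw [Finset.insert_eq_of_mem hj]
          linarith [hmono (Finset.subset_insert i S)]
        · have h1 := abs_le.1 (hest _ (hcard j))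
          have h2 := abs_le.1 (hest _ (hcard i))
          linarith [hi.2.1 j hj, h1.1, h2.2]
      have h0gain : 0 ≤ g (insert i S) - g S + 2 * ε := by
        linarith [hmono (Finset.subset_insert i S)]
      have htot : g T - g S ≤ K * (g (insert i S) - g S + 2 * ε) := by
        refine (hsub S T).trans ((Finset.sum_le_sum fun j _ => hgain j).trans ?_)
        rw [Finset.sum_const, nsmul_eq_mul]
        exact mul_le_mul_of_nonneg_right (by exact_mod_cast hT) h0gain
      have hstep : g T - g (insert i S) ≤ (1 - 1 / (K : ℝ)) * h + 2 * ε := by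
        have h1 : (g T - g S) / K ≤ g (insert i S) - g S + 2 * ε := by
          rw [div_le_iff₀ (by linarith)]; linarith
        have h2 : (1 - 1 / (K : ℝ)) * (g T - g S) ≤ (1 - 1 / (K : ℝ)) * h :=
          mul_le_mul_of_nonneg_left hh hq
        have h3 : (1 - 1 / (K : ℝ)) * (g T - g S) = g T - g S - (g T - g S) / K := by ring
        linarith
      have := ih (insert i S) (by rw [Finset.card_insert_of_notMem hi.1]; omega)
        (by positivity) hstep
      refine this.trans ?_
      have h4 : (1 - 1 / (K : ℝ)) ^ k * (2 * ε) ≤ 2 * ε :=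
        mul_le_of_le_one_left (by positivity) (pow_le_one₀ hq (by simp))
      push_cast
      rw [pow_succ]
      nlinarith

theorem le_run_greedy {g : Finset (Fin n) → ℝ} (hmono : Monotone g) (h0 : g ∅ = 0)
    (hsub : ∀ S T, g T - g S ≤ ∑ i ∈ T, (g (insert i S) - g S)) {k : ℕ} {ε : ℝ}
    (hest : ∀ S : Finset (Fin n), S.card ≤ k → |est S - g S| ≤ ε)
    {T : Finset (Fin n)} (hT : T.card ≤ k) :
    (1 - Real.exp (-1)) * g T - 2 * k * ε ≤ g ((greedy n k).run est) := by
  have hgT : 0 ≤ g T := h0 ▸ hmono (Finset.empty_subset T)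
  rcases k.eq_zero_or_pos with rfl | hk
  · obtain rfl : T = ∅ := Finset.card_eq_zero.1 (Nat.le_zero.1 hT)
    simp [greedy, greedyFrom, h0]
  · have h1 := gap_run_greedyFrom_le est hmono hsub hk hest hT k ∅ (by simp) hgT (by simp [h0])
    have h2 : (1 - 1 / (k : ℝ)) ^ k ≤ Real.exp (-1) :=
      Real.one_sub_div_pow_le_exp_neg (by exact_mod_cast hk)
    have h3 := mul_le_mul_of_nonneg_right h2 hgT
    rw [greedy]
    linarith

end Greedy

/-! ### Existence of medians -/

theorem exists_isMedian {Ω : Type*} [MeasurableSpace Ω] (P : Measure Ω) [IsProbabilityMeasure P]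
    {Z : Ω → ℝ} (hZ : Measurable Z) : ∃ r, IsMedian P Z r := by
  set μ := P.map Z with hμ
  have : IsProbabilityMeasure μ := Measure.isProbabilityMeasure_map hZ.aemeasurable
  set F := ProbabilityTheory.cdf μ with hF
  set A := {x | 1 / 2 ≤ F x} with hA
  have hne : A.Nonempty :=
    ((ProbabilityTheory.tendsto_cdf_atTop μ).eventually (Ici_mem_nhds (a := (1 / 2 : ℝ)) (by norm_num))).exists
  have hbdd : BddBelow A := by
    obtain ⟨b, hb⟩ := ((ProbabilityTheory.tendsto_cdf_atBot μ).eventually_lt_const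
      (u := 1 / 2) (by norm_num)).exists
    refine ⟨b, fun x hx => ?_⟩
    by_contra! hxb
    exact (lt_of_le_of_lt (ProbabilityTheory.monotone_cdf μ hxb.le) hb).not_ge hx
  -- Right continuity gives F ≥ 1/2 at the infimum of {F ≥ 1/2}; the left limit there is at most
  -- 1/2.
  refine ⟨sInf A, ?_, ?_⟩
  · have h1 : 1 / 2 ≤ F (sInf A) := by
      have hc : Filter.Tendsto F (nhdsWithin (sInf A) (Ioi (sInf A))) (nhds (F (sInf A))) :=
        (F.right_continuous (sInf A)).mono_left (nhdsWithin_mono _ Ioi_subset_Ici_self)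
      refine ge_of_tendsto hc ?_
      filter_upwards [self_mem_nhdsWithin] with x hx
      obtain ⟨a, ha, hax⟩ := exists_lt_of_csInf_lt hne hx
      exact le_trans ha (ProbabilityTheory.monotone_cdf μ hax.le)
    have h2 : P {ω | Z ω ≤ sInf A} = μ (Iic (sInf A)) := (Measure.map_apply hZ measurableSet_Iic).symm
    rw [h2, ← ProbabilityTheory.ofReal_cdf]
    refine le_trans (le_of_eq ?_) (ENNReal.ofReal_le_ofReal h1)
    rw [ENNReal.ofReal_div_of_pos two_pos]; simp
  · have h1 : Function.leftLim F (sInf A) ≤ 1 / 2 := by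
      refine le_of_tendsto ((ProbabilityTheory.monotone_cdf μ).tendsto_leftLim (sInf A)) ?_
      filter_upwards [self_mem_nhdsWithin] with x hx
      by_contra! hc
      exact (csInf_le hbdd (show x ∈ A from hc.le)).not_gt hx
    have h2 : P {ω | sInf A ≤ Z ω} = μ (Ici (sInf A)) :=
      (Measure.map_apply hZ measurableSet_Ici).symm
    rw [h2, ← ProbabilityTheory.measure_cdf μ,
      StieltjesFunction.measure_Ici _ (ProbabilityTheory.tendsto_cdf_atTop μ)]
    refine le_trans (le_of_eq ?_) (ENNReal.ofReal_le_ofReal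
      (show (1 / 2 : ℝ) ≤ 1 - Function.leftLim F (sInf A) by linarith))
    rw [ENNReal.ofReal_div_of_pos two_pos]; simp

/-! ### Independent values, virtual surplus and revenue -/

section Product

variable {n : ℕ} (D : Fin n → ValueDist) (κ : Fin n → ℝ)

instance isProbabilityMeasure_valueLaw : IsProbabilityMeasure (valueLaw D) := by
  unfold valueLaw; infer_instance

/-- Drawing the value of one item anew does not change the joint law. -/
theorem measurePreserving_update (i : Fin n) :
    MeasurePreserving (fun a : (Fin n → ℝ) × ℝ => Function.update a.1 i a.2)
      ((valueLaw D).prod (D i).law) (valueLaw D) := by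
  refine ⟨measurable_update', ?_⟩
  refine (Measure.pi_eq (μ := fun i => (D i).law) fun s hs => ?_).symm
  have h : (fun a : (Fin n → ℝ) × ℝ => Function.update a.1 i a.2) ⁻¹' univ.pi s =
      univ.pi (Function.update s i univ) ×ˢ s i := by
    ext a
    simp only [mem_preimage, mem_prod, mem_univ_pi]
    refine ⟨fun h => ⟨fun j => ?_, by simpa using h i⟩, fun h j => ?_⟩
    · rcases eq_or_ne j i with rfl | hj
      · simp
      · simpa [hj] using h j
    · rcases eq_or_ne j i with rfl | hj
      · simpa using h.2
      · simpa [hj] using h.1 j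
  rw [Measure.map_apply measurable_update' (.univ_pi hs), h, Measure.prod_prod, valueLaw,
    Measure.pi_pi, ← Finset.mul_prod_erase _ _ (Finset.mem_univ i),
    ← Finset.mul_prod_erase _ (fun j => (D j).law (s j)) (Finset.mem_univ i), mul_comm]
  rw [Function.update_self, measure_univ, one_mul]
  congr 1
  refine Finset.prod_congr rfl fun j hj => ?_
  rw [Function.update_of_ne (Finset.ne_of_mem_erase hj)]

theorem ae_valueLaw (i : Fin n) {p : ℝ → Prop} (h : ∀ᵐ x ∂(D i).law, p x) :
    ∀ᵐ v ∂valueLaw D, p (v i) :=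
  (measurePreserving_eval (fun i => (D i).law) i).quasiMeasurePreserving.ae h

theorem integral_eval (i : Fin n) {f : ℝ → ℝ} (hf : Measurable f) :
    ∫ v, f (v i) ∂valueLaw D = ∫ x, f x ∂(D i).law := by
  have h := measurePreserving_eval (fun i => (D i).law) i
  have := integral_map (μ := valueLaw D) h.measurable.aemeasurable (f := f)
    hf.aestronglyMeasurable
  rw [← this]
  exact congrArg (fun m => ∫ x, f x ∂m) h.map_eq

theorem integrable_eval (i : Fin n) {f : ℝ → ℝ} (hf : Integrable f (D i).law) :
    Integrable (fun v : Fin n → ℝ => f (v i)) (valueLaw D) :=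
  (measurePreserving_eval (fun i => (D i).law) i).integrable_comp_of_integrable hf

/-- Fubini: conditioning on the other values reduces claims about one item to its own law. -/
theorem integral_nonneg_of_update (i : Fin n) {f : (Fin n → ℝ) → ℝ}
    (hf : Integrable f (valueLaw D))
    (h : ∀ v, 0 ≤ ∫ x, f (Function.update v i x) ∂(D i).law) : 0 ≤ ∫ v, f v ∂valueLaw D := by
  have hm := measurePreserving_update D i
  have h1 : ∫ v, f v ∂valueLaw D =
      ∫ a, f (Function.update a.1 i a.2) ∂((valueLaw D).prod (D i).law) := by
    conv_lhs => rw [← hm.map_eq]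
    exact integral_map hm.measurable.aemeasurable (by rw [hm.map_eq]; exact hf.1)
  rw [h1, integral_prod (fun a : (Fin n → ℝ) × ℝ => f (Function.update a.1 i a.2))
    (hm.integrable_comp_of_integrable hf)]
  exact integral_nonneg h

/-- The value of item `i` is independent of the other values. -/
theorem measure_eval_inter (i : Fin n) {s : Set ℝ} {C : Set (Fin n → ℝ)} (hs : MeasurableSet s)
    (hC : MeasurableSet C) (hCi : ∀ v x, Function.update v i x ∈ C ↔ v ∈ C) :
    (valueLaw D).real {v | v i ∈ s ∧ v ∈ C} = (D i).law.real s * (valueLaw D).real C := by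
  have hm := measurePreserving_update D i
  have h1 : MeasurableSet {v : Fin n → ℝ | v i ∈ s ∧ v ∈ C} :=
    (measurable_pi_apply i hs).inter hC
  have h2 : (fun a : (Fin n → ℝ) × ℝ => Function.update a.1 i a.2) ⁻¹' {v | v i ∈ s ∧ v ∈ C} =
      C ×ˢ s := by
    ext a
    simp [hCi, and_comm]
  rw [measureReal_def, ← hm.measure_preimage h1.nullMeasurableSet, h2, Measure.prod_prod,
    ENNReal.toReal_mul, mul_comm]
  rfl

/-- Given the other values, a tie pins v_i to one point, and its law has no atoms. -/
theorem ae_sub_ne (q : Fin n → ℝ) {i j : Fin n} (hij : i ≠ j) :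
    ∀ᵐ v ∂valueLaw D, v i - q i ≠ v j - q j := by
  have hm := measurePreserving_update D i
  have h1 : MeasurableSet {v : Fin n → ℝ | v i - q i = v j - q j} :=
    measurableSet_eq_fun (by fun_prop) (by fun_prop)
  rw [ae_iff]
  simp only [ne_eq, not_not]
  rw [← hm.measure_preimage h1.nullMeasurableSet,
    Measure.measure_prod_null (hm.measurable h1)]
  refine .of_forall fun v => measure_mono_null (t := {v j - q j + q i}) (fun x hx => ?_)
    (measure_singleton _)
  have hx' : Function.update v i x i - q i = Function.update v i x j - q j := hx
  rw [Function.update_self, Function.update_of_ne hij.symm] at hx'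
  rw [mem_singleton_iff]
  linarith

theorem measurableSet_buysItem (S : Finset (Fin n)) (p : Fin n → ℝ) (i : Fin n) :
    MeasurableSet (buysItem S p i) := by
  have : buysItem S p i = {_v : Fin n → ℝ | i ∈ S} ∩ ({v | 0 ≤ v i - p i} ∩
      ⋂ j ∈ S, {v | v j - p j ≤ v i - p i}) := by
    ext v; simp [buysItem]
  rw [this]
  refine (MeasurableSet.const _).inter ((measurableSet_le (by fun_prop) (by fun_prop)).inter
    (Finset.measurableSet_biInter _ fun j _ => measurableSet_le (by fun_prop) (by fun_prop)))

/-! ### The largest virtual value -/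

theorem maxVirtual_nonneg (S : Finset (Fin n)) (v : Fin n → ℝ) : 0 ≤ maxVirtual D κ S v :=
  (Finset.le_fold_max _).2 (.inl le_rfl)

theorem le_maxVirtual {S : Finset (Fin n)} {i : Fin n} (hi : i ∈ S) (v : Fin n → ℝ) :
    (D i).virtualValue (v i) - κ i ≤ maxVirtual D κ S v :=
  (Finset.le_fold_max _).2 (.inr ⟨i, hi, le_rfl⟩)

theorem maxVirtual_le_iff {S : Finset (Fin n)} {v : Fin n → ℝ} {c : ℝ} :
    maxVirtual D κ S v ≤ c ↔ 0 ≤ c ∧ ∀ i ∈ S, (D i).virtualValue (v i) - κ i ≤ c :=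
  Finset.fold_max_le _

theorem maxVirtual_eq_or (S : Finset (Fin n)) (v : Fin n → ℝ) :
    maxVirtual D κ S v = 0 ∨ ∃ i ∈ S, maxVirtual D κ S v = (D i).virtualValue (v i) - κ i := by
  rcases (Finset.le_fold_max _).1 (le_refl (maxVirtual D κ S v)) with h | ⟨i, hi, h⟩
  · exact .inl (h.antisymm (maxVirtual_nonneg D κ S v))
  · exact .inr ⟨i, hi, h.antisymm (le_maxVirtual D κ hi v)⟩

theorem maxVirtual_mono {S T : Finset (Fin n)} (h : S ⊆ T) (v : Fin n → ℝ) :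
    maxVirtual D κ S v ≤ maxVirtual D κ T v :=
  (maxVirtual_le_iff D κ).2 ⟨maxVirtual_nonneg D κ T v, fun _ hi => le_maxVirtual D κ (h hi) v⟩

theorem measurable_netVirtual (i : Fin n) :
    Measurable fun v : Fin n → ℝ => (D i).virtualValue (v i) - κ i :=
  ((D i).measurable_virtualValue.comp (measurable_pi_apply i)).sub_const _

theorem integrable_netVirtual (i : Fin n) :
    Integrable (fun v : Fin n → ℝ => (D i).virtualValue (v i) - κ i) (valueLaw D) :=
  (integrable_eval D i (D i).integrable_virtualValue).sub (integrable_const _)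

theorem integrable_maxVirtual (S : Finset (Fin n)) :
    Integrable (maxVirtual D κ S) (valueLaw D) := by
  induction S using Finset.induction_on with
  | empty => exact integrable_const 0
  | insert i S hi ih =>
    have : maxVirtual D κ (insert i S) =
        (fun v => (D i).virtualValue (v i) - κ i) ⊔ maxVirtual D κ S := by
      ext v; exact Finset.fold_insert hi
    rw [this]
    exact (integrable_netVirtual D κ i).sup ih

theorem measurable_maxVirtual (S : Finset (Fin n)) : Measurable (maxVirtual D κ S) := by
  induction S using Finset.induction_on with
  | empty => exact measurable_const (a := (0 : ℝ))
  | insert i S hi ih =>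
    have : maxVirtual D κ (insert i S) =
        (fun v => (D i).virtualValue (v i) - κ i) ⊔ maxVirtual D κ S := by
      ext v; exact Finset.fold_insert hi
    rw [this]
    exact (measurable_netVirtual D κ i).sup ih

theorem expMaxVirtual_empty : expMaxVirtual D κ ∅ = 0 := by
  simp [expMaxVirtual, maxVirtual]

theorem monotone_expMaxVirtual : Monotone (expMaxVirtual D κ) := fun S T h =>
  integral_mono (integrable_maxVirtual D κ S) (integrable_maxVirtual D κ T)
    (maxVirtual_mono D κ h)

/-- Holds pointwise: the maximum over `T` is 0 or attained at a single item, whose marginal gain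
alone covers the difference. -/
theorem expMaxVirtual_sub_le (S T : Finset (Fin n)) :
    expMaxVirtual D κ T - expMaxVirtual D κ S ≤
      ∑ i ∈ T, (expMaxVirtual D κ (insert i S) - expMaxVirtual D κ S) := by
  have hi := integrable_maxVirtual D κ
  simp only [expMaxVirtual]
  simp only [← integral_sub (hi _) (hi _)]
  have hd (S S' : Finset (Fin n)) :
      Integrable (fun v => maxVirtual D κ S v - maxVirtual D κ S' v) (valueLaw D) :=
    (hi S).sub (hi S')
  rw [← integral_finsetSum _ fun i _ => hd _ _]
  refine integral_mono (hd _ _) (integrable_finsetSum _ fun i _ => hd _ _) fun v => ?_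
  have hnn (i : Fin n) : 0 ≤ maxVirtual D κ (insert i S) v - maxVirtual D κ S v :=
    sub_nonneg.2 (maxVirtual_mono D κ (Finset.subset_insert i S) v)
  dsimp only
  rcases maxVirtual_eq_or D κ T v with h | ⟨i, hiT, h⟩
  · rw [h]
    linarith [Finset.sum_nonneg fun i (_ : i ∈ T) => hnn i, maxVirtual_nonneg D κ S v]
  · refine le_trans ?_ (Finset.single_le_sum (fun j _ => hnn j) hiT)
    rw [h]
    exact sub_le_sub_right (le_maxVirtual D κ (Finset.mem_insert_self i S) v) _

theorem expMaxVirtual_le_of_le {κ κ' : Fin n → ℝ} (h : ∀ i, κ' i ≤ κ i) (S : Finset (Fin n)) :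
    expMaxVirtual D κ S ≤ expMaxVirtual D κ' S := by
  refine integral_mono (integrable_maxVirtual D κ S) (integrable_maxVirtual D κ' S) fun v => ?_
  refine (maxVirtual_le_iff D κ).2 ⟨maxVirtual_nonneg D κ' S v, fun i hi => ?_⟩
  exact (sub_le_sub_left (h i) _).trans (le_maxVirtual D κ' hi v)

theorem expMaxVirtual_congr {κ κ' : Fin n → ℝ} {S : Finset (Fin n)} (h : ∀ i ∈ S, κ' i = κ i) :
    expMaxVirtual D κ' S = expMaxVirtual D κ S := by
  simp only [expMaxVirtual]
  congr 1
  ext v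
  exact Finset.fold_congr fun i hi => by rw [h i hi]

/-! ### Bounds on the revenue -/

theorem mul_measure_buysItem_le (T : Finset (Fin n)) (q : Fin n → ℝ) (i : Fin n) :
    (q i - κ i) * (valueLaw D).real (buysItem T q i) ≤
      ∫ v in buysItem T q i, ((D i).virtualValue (v i) - κ i) ∂valueLaw D := by
  by_cases hiT : i ∈ T
  swap
  · have : buysItem T q i = ∅ := by ext v; simp [buysItem, hiT]
    simp [this]
  have hB := measurableSet_buysItem T q i
  have hint : IntegrableOn (fun v : Fin n → ℝ => (D i).virtualValue (v i) - κ i - (q i - κ i))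
      (buysItem T q i) (valueLaw D) :=
    ((integrable_netVirtual D κ i).sub (integrable_const _)).integrableOn
  have key : 0 ≤ ∫ v, (buysItem T q i).indicator
      (fun v => (D i).virtualValue (v i) - κ i - (q i - κ i)) v ∂valueLaw D := by
    refine integral_nonneg_of_update D i (hint.integrable_indicator hB) fun v => ?_
    obtain ⟨t, ht, hslice⟩ : ∃ t, q i ≤ t ∧ ∀ x, Function.update v i x ∈ buysItem T q i ↔ t ≤ x := by
      -- The threshold is the price plus the surplus of the best alternative, which includes buying
      -- nothing.
      refine ⟨q i + (T.erase i).fold max 0 fun j => v j - q j,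
        le_add_of_nonneg_right ((Finset.le_fold_max _).2 (.inl le_rfl)), fun x => ?_⟩
      rw [← le_sub_iff_add_le', Finset.fold_max_le]
      simp only [buysItem, mem_ofPred_eq, Function.update_self, hiT, true_and]
      refine and_congr_right fun hx => ⟨fun h j hj => ?_, fun h j hj => ?_⟩
      · have := h j (Finset.mem_of_mem_erase hj)
        rwa [Function.update_of_ne (Finset.ne_of_mem_erase hj)] at this
      · by_cases hji : j = i
        · rw [hji, Function.update_self]
        · rw [Function.update_of_ne hji]
          exact h j (Finset.mem_erase.2 ⟨hji, hj⟩)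
    have h1 : (fun x => (buysItem T q i).indicator
        (fun v => (D i).virtualValue (v i) - κ i - (q i - κ i)) (Function.update v i x)) =
        (Ici t).indicator fun x => (D i).virtualValue x - q i := by
      ext x
      by_cases hx : t ≤ x
      · rw [indicator_of_mem ((hslice x).2 hx), indicator_of_mem (mem_Ici.2 hx),
          Function.update_self]
        ring
      · rw [indicator_of_notMem (mt (hslice x).1 hx), indicator_of_notMem (mt mem_Ici.1 hx)]
    rw [h1, integral_indicator measurableSet_Ici,
      integral_sub (D i).integrable_virtualValue.integrableOn (integrable_const _),
      setIntegral_const, smul_eq_mul]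
    have h2 := (D i).mul_meas_Ici_le t
    have h3 := mul_le_mul_of_nonneg_right ht (measureReal_nonneg (μ := (D i).law) (s := Ici t))
    linarith
  rw [integral_indicator hB, integral_sub (integrable_netVirtual D κ i).integrableOn
    (integrable_const _), setIntegral_const, smul_eq_mul] at key
  linarith

/-- The revenue is at most the expected largest virtual value. -/
theorem revenue_le_expMaxVirtual (T : Finset (Fin n)) (q : Fin n → ℝ) :
    revenue D κ T q ≤ expMaxVirtual D κ T := by
  have hB := measurableSet_buysItem T q
  refine (Finset.sum_le_sum fun i _ => mul_measure_buysItem_le D κ T q i).trans ?_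
  simp only [← integral_indicator (hB _)]
  have hint (i : Fin n) := (integrable_netVirtual D κ i).indicator (hB i)
  rw [← integral_finsetSum _ fun i _ => hint i]
  refine integral_mono_ae (integrable_finsetSum _ fun i _ => hint i)
    (integrable_maxVirtual D κ T) ?_
  have hties : ∀ᵐ v ∂valueLaw D, ∀ i j : Fin n, i ≠ j → v i - q i ≠ v j - q j := by
    simp only [ae_all_iff, Filter.eventually_imp_distrib_left]
    exact fun i j hij => ae_sub_ne D q hij
  filter_upwards [hties] with v hv
  -- Without ties at most one summand is nonzero.
  by_cases h : ∃ i ∈ T, v ∈ buysItem T q i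
  · obtain ⟨i, hi, hvi⟩ := h
    rw [Finset.sum_eq_single i]
    · rw [indicator_of_mem hvi]
      exact le_maxVirtual D κ hi v
    · intro j hj hji
      refine indicator_of_notMem (fun hvj => hv j i hji ?_) _
      exact (hvi.2.2 j hj).antisymm (hvj.2.2 i hi)
    · exact fun hi' => absurd hi hi'
  · push Not at h
    rw [Finset.sum_eq_zero fun i hi => indicator_of_notMem (h i hi) _]
    exact maxVirtual_nonneg D κ T v

/-- The maximum is at most r plus the sum of all excesses over r, and each expected excess equals
the margin above r earned by selling that item alone at its reserve price. -/
theorem expMaxVirtual_le_add_sum (hD : ∀ i, (D i).IsRegular) (S : Finset (Fin n)) {r : ℝ}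
    (hr : 0 ≤ r) : expMaxVirtual D κ S ≤ r + ∑ i ∈ S,
      (virtualReservePrices D κ r i - κ i - r) *
        (D i).law.real (Ici (virtualReservePrices D κ r i)) := by
  have hint (i : Fin n) : Integrable
      (fun v : Fin n → ℝ => max ((D i).virtualValue (v i) - (r + κ i)) 0) (valueLaw D) :=
    ((integrable_eval D i (D i).integrable_virtualValue).sub (integrable_const _)).pos_part
  have h1 : expMaxVirtual D κ S ≤ ∫ v, (r + ∑ i ∈ S,
      max ((D i).virtualValue (v i) - (r + κ i)) 0) ∂valueLaw D := by
    refine integral_mono (integrable_maxVirtual D κ S)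
      ((integrable_const r).add (integrable_finsetSum _ fun i _ => hint i)) fun v => ?_
    have hnn (i : Fin n) : 0 ≤ max ((D i).virtualValue (v i) - (r + κ i)) 0 := le_max_right _ _
    refine (maxVirtual_le_iff D κ).2 ⟨add_nonneg hr (Finset.sum_nonneg fun i _ => hnn i),
      fun i hi => ?_⟩
    have h2 := Finset.single_le_sum (fun j _ => hnn j) hi
    have h3 := le_max_left ((D i).virtualValue (v i) - (r + κ i)) 0
    linarith
  refine h1.trans_eq ?_
  rw [integral_add (integrable_const r) (integrable_finsetSum _ fun i _ => hint i),
    integral_finsetSum _ fun i _ => hint i]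
  simp only [integral_const, probReal_univ, smul_eq_mul, one_mul]
  congr 1
  refine Finset.sum_congr rfl fun i _ => ?_
  rw [integral_eval D i (f := fun x => max ((D i).virtualValue x - (r + κ i)) 0)
    (((D i).measurable_virtualValue.sub_const _).max measurable_const),
    (D i).integral_posPart_virtualValue (hD i), virtualReservePrices]
  ring

theorem half_le_measureReal {Ω : Type*} [MeasurableSpace Ω] {P : Measure Ω} [IsFiniteMeasure P]
    {A B : Set Ω} (h : 1 / 2 ≤ P A) (hAB : A ≤ᵐ[P] B) : 1 / 2 ≤ P.real B := by
  have := ENNReal.toReal_mono (measure_ne_top P B) (h.trans (measure_mono_ae hAB))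
  simpa [measureReal_def] using this

theorem nonneg_of_isMedian {S : Finset (Fin n)} {r : ℝ}
    (hr : IsMedian (valueLaw D) (maxVirtual D κ S) r) : 0 ≤ r := by
  by_contra! h
  have : {v | maxVirtual D κ S v ≤ r} = ∅ := by
    ext v
    simpa using h.trans_le (maxVirtual_nonneg D κ S v)
  simpa [this] using hr.1

/-- Anonymous virtual reserve prices for a median guarantee half of the expected largest virtual
value. -/
theorem half_expMaxVirtual_le_revenue (hD : ∀ i, (D i).IsRegular) (S : Finset (Fin n)) {r : ℝ}
    (hr : IsMedian (valueLaw D) (maxVirtual D κ S) r) :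
    expMaxVirtual D κ S / 2 ≤ revenue D κ S (virtualReservePrices D κ r) := by
  have hr0 := nonneg_of_isMedian D κ hr
  have hZ := expMaxVirtual_le_add_sum D κ hD S hr0
  set p := virtualReservePrices D κ r with hp
  have hprice (i : Fin n) : 0 ≤ p i - κ i - r := by
    have := (D i).le_virtualInverse (r + κ i)
    simp only [hp, virtualReservePrices]
    linarith
  have hsell : ∀ᵐ v ∂valueLaw D, ∀ i, p i ≤ v i ↔ r + κ i ≤ (D i).virtualValue (v i) :=
    ae_all_iff.2 fun i => ae_valueLaw D i ((D i).ae_virtualInverse_le_iff (hD i) (r + κ i))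
  have hne : ∀ᵐ v ∂valueLaw D, ∀ i, (D i).virtualValue (v i) ≠ r + κ i :=
    ae_all_iff.2 fun i => ae_valueLaw D i ((D i).ae_virtualValue_ne (hD i) (r + κ i))
  have hsale : r / 2 ≤ r * ∑ i ∈ S, (valueLaw D).real (buysItem S p i) := by
    -- For r = 0 the event Z ≥ r does not force a sale, but the term vanishes.
    rcases hr0.eq_or_lt with h0 | h0
    · simp [← h0]
    have h1 : 1 / 2 ≤ (valueLaw D).real (⋃ i ∈ S, buysItem S p i) := by
      refine half_le_measureReal hr.2 ?_
      filter_upwards [hsell] with v hv (hZv : r ≤ maxVirtual D κ S v)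
      obtain ⟨i, hi, hri⟩ := ((Finset.le_fold_max _).1 hZv).resolve_left h0.not_ge
      obtain ⟨j, hj, hmax⟩ := S.exists_max_image (fun j => v j - p j) ⟨i, hi⟩
      have hpi := (hv i).2 (by linarith)
      exact mem_biUnion hj ⟨hj, (sub_nonneg.2 hpi).trans (hmax i hi), hmax⟩
    have h2 := h1.trans (measureReal_biUnion_finset_le S (buysItem S p))
    nlinarith
  have hmargin (i : Fin n) (hi : i ∈ S) :
      (D i).law.real (Ici (p i)) / 2 ≤ (valueLaw D).real (buysItem S p i) := by
    -- No other item is affordable on `C`. It contains {Z ≤ r} up to a null set, since equality of a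
    -- net virtual value with r has probability zero, and it does not depend on v_i.
    set C : Set (Fin n → ℝ) := ⋂ j ∈ S.erase i, {v | v j < p j} with hC
    have hCm : MeasurableSet C := Finset.measurableSet_biInter _ fun j _ =>
      measurableSet_lt (by fun_prop) measurable_const
    have h1 : 1 / 2 ≤ (valueLaw D).real C := by
      refine half_le_measureReal hr.1 ?_
      filter_upwards [hsell, hne] with v hv hv' (hZv : maxVirtual D κ S v ≤ r)
      refine mem_iInter₂.2 fun j hj => show v j < p j from lt_of_not_ge fun hpj => hv' j ?_
      have := ((maxVirtual_le_iff D κ).1 hZv).2 j (Finset.mem_of_mem_erase hj)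
      exact le_antisymm (by linarith) ((hv j).1 hpj)
    have h2 := measure_eval_inter D i (measurableSet_Ici (a := p i)) hCm fun v x => by
      simp only [hC, mem_iInter, mem_ofPred_eq]
      refine forall₂_congr fun j hj => ?_
      rw [Function.update_of_ne (Finset.ne_of_mem_erase hj)]
    have h3 : (valueLaw D).real {v | v i ∈ Ici (p i) ∧ v ∈ C} ≤
        (valueLaw D).real (buysItem S p i) := by
      refine measureReal_mono fun v hv => ⟨hi, sub_nonneg.2 hv.1, fun j hj => ?_⟩
      by_cases hji : j = i
      · rw [hji]
      · have h4 : v j < p j := mem_iInter₂.1 hv.2 j (Finset.mem_erase.2 ⟨hji, hj⟩)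
        have h5 : p i ≤ v i := hv.1
        linarith
    nlinarith [measureReal_nonneg (μ := (D i).law) (s := Ici (p i))]
  -- Each sale earns the common reserve r plus a nonnegative margin; the two parts match the two
  -- terms of `hZ`.
  have hsplit : revenue D κ S p = r * ∑ i ∈ S, (valueLaw D).real (buysItem S p i) +
      ∑ i ∈ S, (p i - κ i - r) * (valueLaw D).real (buysItem S p i) := by
    rw [revenue, Finset.mul_sum, ← Finset.sum_add_distrib]
    exact Finset.sum_congr rfl fun i _ => by ring
  have hsum : (∑ i ∈ S, (p i - κ i - r) * (D i).law.real (Ici (p i))) / 2 ≤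
      ∑ i ∈ S, (p i - κ i - r) * (valueLaw D).real (buysItem S p i) := by
    rw [Finset.sum_div]
    refine Finset.sum_le_sum fun i hi => ?_
    rw [mul_div_assoc]
    exact mul_le_mul_of_nonneg_left (hmargin i hi) (hprice i)
  linarith

end Product

theorem mainTheorem7 {n : ℕ} (k : ℕ) (D : Fin n → ValueDist) (hD : ∀ i, (D i).IsRegular) :
    (∀ (κ : Fin n → ℝ) (est : Finset (Fin n) → ℝ) (ε : ℝ),
      (∀ S : Finset (Fin n), S.card ≤ k → |est S - expMaxVirtual D κ S| ≤ ε) →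
        ((greedy n k).run est).card = min k n ∧
        (greedy n k).queries est ≤ k * n ∧
        (∃ r : ℝ, IsMedian (valueLaw D) (maxVirtual D κ ((greedy n k).run est)) r) ∧
        ∀ r : ℝ, IsMedian (valueLaw D) (maxVirtual D κ ((greedy n k).run est)) r →
          ∀ (T : Finset (Fin n)) (q : Fin n → ℝ), T.card ≤ k →
            (Real.exp 1 - 1) / (2 * Real.exp 1) * revenue D κ T q - k * ε
              ≤ revenue D κ ((greedy n k).run est) (virtualReservePrices D κ r)) ∧
    (∀ (κ κ' : Fin n → ℝ) (i : Fin n), κ' i ≤ κ i → (∀ j, j ≠ i → κ' j = κ j) →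
      i ∈ (greedy n k).run (expMaxVirtual D κ) →
        i ∈ (greedy n k).run (expMaxVirtual D κ')) := by
  refine ⟨fun κ est ε hest => ⟨?_, queries_greedyFrom_le est k ∅, exists_isMedian _
    (measurable_maxVirtual D κ _), fun r hr T q hT => ?_⟩, fun κ κ' i hi hne h => ?_⟩
  · simpa [greedy] using card_run_greedyFrom est k ∅
  · have h1 := le_run_greedy est (monotone_expMaxVirtual D κ) (expMaxVirtual_empty D κ)
      (expMaxVirtual_sub_le D κ) hest hT
    have h2 := half_expMaxVirtual_le_revenue D κ hD _ hr
    have h3 := revenue_le_expMaxVirtual D κ T q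
    have h4 : (Real.exp 1 - 1) / (2 * Real.exp 1) = (1 - Real.exp (-1)) / 2 := by
      rw [Real.exp_neg]
      field_simp
    have h5 : Real.exp (-1) ≤ 1 := Real.exp_le_one_iff.2 (by norm_num)
    have h6 := mul_le_mul_of_nonneg_left h3 (sub_nonneg.2 h5)
    rw [h4]
    linarith
  · refine mem_run_greedyFrom_of_le (fun S hS => ?_) (expMaxVirtual_le_of_le D fun j => ?_) k ∅ h
    · exact expMaxVirtual_congr D fun j hj => hne j fun hji => hS (hji ▸ hj)
    · by_cases hji : j = i
      · exact hji ▸ hi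
      · exact (hne j hji).le
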